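/- **Proposition.** Let $X,\partial X,\partial Y$ be complex Banach spaces, with $\partial Y$ continuously embedded in $\partial X$. Let $A:D(A)\subset X\to X$, $D:D(D)\subset\partial X\to\partial X$, $B:D(B)\subset\partial X\to X$ (with $D(D)\subset D(B)$) and $C:D(C)\subset X\to\partial X$ (with $D(A)\subset D(C)$) be linear operators, and let $L:D(A)\to\partial Y$ be linear and surjective. Assume that $\binom{A}{L}$ is closed as an operator from $X$ to $X\times\partial Y$ and that $A_0:=A_{|\ker L}$ has nonempty resolvent set. Consider on $X\times\partial X$ the operator matrix $$\mathbf A=\begin{pmatrix}A&B\\ C&D\end{pmatrix},\qquad D(\mathbf A)=\left\{\binom{u}{x}\in D(A)\times(D(D)\cap\partial Y): Lu=x\right\}.$$ Assume that $A_0$ is invertible (with bounded inverse $A_0^{-1}$ defined on $X$); that the Dirichlet operator $D_0^{A,L}:\partial Y\to X$, which maps $y$ to the unique solution $u\in D(A)$ of $Au=0$, $Lu=y$, extends to a bounded operator $\overline{D_0^{A,L}}\in\mathcal L(\partial X,X)$; and that $B-\overline{D_0^{A,L}}D$, defined on $D(D)\cap\partial Y$, extends to a bounded operator $K\in\mathcal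 L(\partial X,X)$. Let $C=0$, let $A_0$ generate a uniformly exponentially stable $C_0$-semigroup $(e^{tA_0})_{t\ge0}$ on $X$, and let $D$ (with domain $D(D)\cap\partial Y$) generate a $C_0$-semigroup $(e^{tD})_{t\ge0}$ on $\partial X$. Put $$S(t)y:=\int_0^t e^{(t-s)A_0}K e^{sD}y\,ds,\qquad t\ge0,\ y\in\partial X.$$ Then $\mathbf A$ generates a $C_0$-semigroup on $X\times\partial X$, namely $$e^{t\mathbf A}=\begin{pmatrix}e^{tA_0}&\widetilde S(t)\\0&e^{tD}\end{pmatrix},\qquad \widetilde S(t)=S(t)+\overline{D_0^{A,L}}e^{tD}-e^{tA_0}\overline{D_0^{A,L}},\qquad t\ge0,$$ and the following hold for every $y\in\partial X$. 1. If the orbit $(e^{tD}y)_{t\ge0}$ is bounded, then $(S(t)y)_{t\ge0}$ and $(\widetilde S(t)y)_{t\ge0}$ are bounded. 2. If moreover $(e^{tD}y)_{t\ge0}$ is asymptotically almost periodic (that is, the sum on $[0,\infty)$ of a Bohr almost periodic function on $\mathbb R$ and of a continuous function vanishing at infinity), then so are $(S(t)y)_{t\ge0}$ and $(\widetilde S(t)y)_{t\ge0}$.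 3. If $z:=\lim_{t\to\infty}e^{tD}y$ exists, then $z\in D(B)$ and $$\lim_{t\to\infty}S(t)y=-A_0^{-1}Bz,\qquad \lim_{t\to\infty}\widetilde S(t)y=\overline{D_0^{A,L}}z-A_0^{-1}Bz.$$ 4. If $(e^{tD})_{t\ge0}$ is uniformly exponentially stable, then $(e^{t\mathbf A})_{t\ge0}$ is uniformly exponentially stable. -/

import Mathlib

open Set Filter Topology

noncomputable section

/-- A strongly continuous semigroup `(T(t))_{t ≥ 0}` of bounded linear operators; the values at
negative times are irrelevant. -/
structure C0Semigroup (E : Type*) [NormedAddCommGroup E] [NormedSpace ℂ E] where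
  toFun : ℝ → E →L[ℂ] E
  map_zero : toFun 0 = ContinuousLinearMap.id ℂ E
  map_add : ∀ s t : ℝ, 0 ≤ s → 0 ≤ t → toFun (s + t) = (toFun s).comp (toFun t)
  continuousOn_orbit : ∀ x : E, ContinuousOn (fun t : ℝ => toFun t x) (Ici 0)

instance C0Semigroup.instCoeFun {E : Type*} [NormedAddCommGroup E] [NormedSpace ℂ E] :
    CoeFun (C0Semigroup E) (fun _ => ℝ → E →L[ℂ] E) := ⟨C0Semigroup.toFun⟩

/-- `G` is the generator of the semigroup `T`: `x ∈ D(G)` and `G x = y` if and only if the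
difference quotients `(T(t) x - x) / t` converge to `y` as `t ↓ 0`. -/
def IsGenerator {E : Type*} [NormedAddCommGroup E] [NormedSpace ℂ E]
    (T : C0Semigroup E) (G : E →ₗ.[ℂ] E) : Prop :=
  ∀ x y : E, (x, y) ∈ G.graph ↔
    Tendsto (fun t : ℝ => t⁻¹ • (T t x - x)) (𝓝[>] 0) (𝓝 y)

/-- Uniform exponential stability. -/
def UniformlyExponentiallyStable {E : Type*} [NormedAddCommGroup E] [NormedSpace ℂ E]
    (T : C0Semigroup E) : Prop :=
  ∃ M ε : ℝ, 0 < ε ∧ ∀ t : ℝ, 0 ≤ t → ‖T t‖ ≤ M * Real.exp (-ε * t)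

/-- Boundedness on `[0, ∞)`. -/
def BoundedOnHalfLine {E : Type*} [NormedAddCommGroup E] (f : ℝ → E) : Prop :=
  ∃ M : ℝ, ∀ t : ℝ, 0 ≤ t → ‖f t‖ ≤ M

/-- (Bohr) almost periodic functions on the line: continuous, and for each `ε > 0` the set of
`ε`-periods is relatively dense. -/
def AlmostPeriodic {E : Type*} [NormedAddCommGroup E] (g : ℝ → E) : Prop :=
  Continuous g ∧ ∀ ε : ℝ, 0 < ε → ∃ l : ℝ, 0 < l ∧ ∀ a : ℝ, ∃ τ ∈ Icc a (a + l),
    ∀ t : ℝ, ‖g (t + τ) - g t‖ ≤ ε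

/-- Asymptotically almost periodic functions on `[0, ∞)`: the sum of (the restriction of) an almost
periodic function and of a continuous function on `[0, ∞)` that vanishes at infinity. -/
def AsymptoticallyAlmostPeriodic {E : Type*} [NormedAddCommGroup E] (f : ℝ → E) : Prop :=
  ∃ g h : ℝ → E, AlmostPeriodic g ∧ ContinuousOn h (Ici 0) ∧ Tendsto h atTop (𝓝 0) ∧
    ∀ t : ℝ, 0 ≤ t → f t = g t + h t

/-- `R` is the bounded, everywhere defined, two-sided inverse of the operator `G`. -/
def IsBoundedInverse {E : Type*} [NormedAddCommGroup E] [NormedSpace ℂ E]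
    (G : E →ₗ.[ℂ] E) (R : E →L[ℂ] E) : Prop :=
  (∀ x : E, ∃ hx : R x ∈ G.domain, G ⟨R x, hx⟩ = x) ∧ ∀ x : G.domain, R (G x) = x

/-- The resolvent set of an unbounded operator. -/
def resolventSetOf {E : Type*} [NormedAddCommGroup E] [NormedSpace ℂ E]
    (G : E →ₗ.[ℂ] E) : Set ℂ :=
  {z : ℂ | ∃ R : E →L[ℂ] E,
    IsBoundedInverse ((-(z • (LinearMap.id : E →ₗ[ℂ] E))) +ᵥ G) R}

/-- The entries of an operator matrix `(A B; C D)` on `X × bX` with the coupling `L u = x`: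
`bX` is the boundary space and `bY` a space mapped into `bX` by `ι`. -/
structure CoupledMatrix (X bX bY : Type*)
    [NormedAddCommGroup X] [NormedSpace ℂ X]
    [NormedAddCommGroup bX] [NormedSpace ℂ bX]
    [NormedAddCommGroup bY] [NormedSpace ℂ bY] where
  ι : bY →L[ℂ] bX
  A : X →ₗ.[ℂ] X
  L : A.domain →ₗ[ℂ] bY
  D : bX →ₗ.[ℂ] bX
  B : bX →ₗ.[ℂ] X
  C : X →ₗ.[ℂ] bX
  domD_le : D.domain ≤ B.domain
  domA_le : A.domain ≤ C.domain

namespace CoupledMatrix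

variable {X bX bY : Type*}
  [NormedAddCommGroup X] [NormedSpace ℂ X]
  [NormedAddCommGroup bX] [NormedSpace ℂ bX]
  [NormedAddCommGroup bY] [NormedSpace ℂ bY]

/-- `A₀`, the restriction of `A` to `ker L`. -/
def A₀ (m : CoupledMatrix X bX bY) : X →ₗ.[ℂ] X :=
  m.A.domRestrict ((LinearMap.ker m.L).map m.A.domain.subtype)

/-- The operator `(A; L)` from `X` to `X × bY`, with domain `D(A)`. -/
def AL (m : CoupledMatrix X bX bY) : X →ₗ.[ℂ] (X × bY) :=
  ⟨m.A.domain, m.A.toFun.prod m.L⟩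

/-- The operator `D` with domain `D(D) ∩ bY`. -/
def boundaryD (m : CoupledMatrix X bX bY) : bX →ₗ.[ℂ] bX :=
  m.D.domRestrict (LinearMap.range (m.ι : bY →ₗ[ℂ] bX))

/-- The coupled domain: pairs `(u, x)` with `u ∈ D(A)`, `x ∈ D(D) ∩ bY`, `L u = x`. -/
def coupledDomain (m : CoupledMatrix X bX bY) : Submodule ℂ (X × bX) where
  carrier := {p | ∃ hu : p.1 ∈ m.A.domain, p.2 ∈ m.D.domain ∧ m.ι (m.L ⟨p.1, hu⟩) = p.2}
  zero_mem' := ⟨m.A.domain.zero_mem, m.D.domain.zero_mem, by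
    have h : (⟨(0 : X × bX).1, m.A.domain.zero_mem⟩ : m.A.domain) = 0 := rfl
    rw [h, map_zero, map_zero]; rfl⟩
  add_mem' := by
    rintro p q ⟨hp, hp', hpL⟩ ⟨hq, hq', hqL⟩
    refine ⟨m.A.domain.add_mem hp hq, m.D.domain.add_mem hp' hq', ?_⟩
    have h : (⟨(p + q).1, m.A.domain.add_mem hp hq⟩ : m.A.domain) = ⟨p.1, hp⟩ + ⟨q.1, hq⟩ := rfl
    rw [h, map_add, map_add, hpL, hqL]; rfl
  smul_mem' := by
    rintro c p ⟨hp, hp', hpL⟩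
    refine ⟨m.A.domain.smul_mem c hp, m.D.domain.smul_mem c hp', ?_⟩
    have h : (⟨(c • p).1, m.A.domain.smul_mem c hp⟩ : m.A.domain) = c • ⟨p.1, hp⟩ := rfl
    rw [h, map_smul, map_smul, hpL]; rfl

/-- The operator matrix `(u, x) ↦ (A u + B x, C u + D x)` with coupled domain. -/
def toOperator (m : CoupledMatrix X bX bY) : (X × bX) →ₗ.[ℂ] (X × bX) where
  domain := m.coupledDomain
  toFun :=
    { toFun := fun p =>
        (m.A ⟨p.1.1, p.2.1⟩ + m.B ⟨p.1.2, m.domD_le p.2.2.1⟩,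
          m.C ⟨p.1.1, m.domA_le p.2.1⟩ + m.D ⟨p.1.2, p.2.2.1⟩)
      map_add' := by
        intro p q
        have h1 := m.A.map_add ⟨p.1.1, p.2.1⟩ ⟨q.1.1, q.2.1⟩
        have h2 := m.B.map_add ⟨p.1.2, m.domD_le p.2.2.1⟩ ⟨q.1.2, m.domD_le q.2.2.1⟩
        have h3 := m.C.map_add ⟨p.1.1, m.domA_le p.2.1⟩ ⟨q.1.1, m.domA_le q.2.1⟩
        have h4 := m.D.map_add ⟨p.1.2, p.2.2.1⟩ ⟨q.1.2, q.2.2.1⟩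
        refine Prod.ext ((congrArg₂ (· + ·) h1 h2).trans ?_)
          ((congrArg₂ (· + ·) h3 h4).trans ?_)
        · exact add_add_add_comm _ _ _ _
        · exact add_add_add_comm _ _ _ _
      map_smul' := by
        intro c p
        have h1 := m.A.map_smul c ⟨p.1.1, p.2.1⟩
        have h2 := m.B.map_smul c ⟨p.1.2, m.domD_le p.2.2.1⟩
        have h3 := m.C.map_smul c ⟨p.1.1, m.domA_le p.2.1⟩
        have h4 := m.D.map_smul c ⟨p.1.2, p.2.2.1⟩
        refine Prod.ext ((congrArg₂ (· + ·) h1 h2).trans ?_)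
          ((congrArg₂ (· + ·) h3 h4).trans ?_)
        · exact (smul_add _ _ _).symm
        · exact (smul_add _ _ _).symm }

/-- The standing assumptions on the entries (linearity and the inclusions `D(D) ⊆ D(B)`,
`D(A) ⊆ D(C)` are part of the data): `bY` is continuously embedded in `bX`, `L` maps `D(A)` onto
`bY`, `A₀` has nonempty resolvent set, and `(A; L)` is closed from `X` to `X × bY`. -/
structure BasicAssumptions (m : CoupledMatrix X bX bY) : Prop where
  embedding : Function.Injective m.ι
  surjective : Function.Surjective m.L
  resolvent_nonempty : (resolventSetOf m.A₀).Nonempty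
  closed : m.AL.IsClosed

/-- `u` solves the abstract Dirichlet problem `A u = z u`, `L u = y`. -/
def SolvesDirichlet (m : CoupledMatrix X bX bY) (z : ℂ) (y : bY) (u : X) : Prop :=
  ∃ hu : u ∈ m.A.domain, m.A ⟨u, hu⟩ = z • u ∧ m.L ⟨u, hu⟩ = y

/-- `E` is a bounded extension to `bX` of the Dirichlet operator, that is, of the solution operator
`y ↦ u` (for `y ∈ bY`) of the abstract Dirichlet problem with parameter `z`. -/
def ExtendsDirichlet (m : CoupledMatrix X bX bY) (z : ℂ) (E : bX →L[ℂ] X) : Prop :=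
  ∀ y : bY, m.SolvesDirichlet z y (E (m.ι y))

/-- `K` is a bounded operator from `bX` to `X` that extends `B - E D`, defined on
`D(D) ∩ bY`. -/
def ExtendsBSubED (m : CoupledMatrix X bX bY) (E K : bX →L[ℂ] X) : Prop :=
  ∀ (x : bX) (hx : x ∈ m.D.domain), x ∈ range m.ι →
    K x = m.B ⟨x, m.domD_le hx⟩ - E (m.D ⟨x, hx⟩)

end CoupledMatrix

/-- The convolution operators `y ↦ ∫₀ᵗ T(t - s) K U(s) y ds`. -/
def convolutionOp {X Y : Type*} [NormedAddCommGroup X] [NormedSpace ℂ X]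
    [NormedAddCommGroup Y] [NormedSpace ℂ Y]
    (T : C0Semigroup X) (K : Y →L[ℂ] X) (U : C0Semigroup Y) (t : ℝ) (y : Y) : X :=
  ∫ s in (0 : ℝ)..t, T (t - s) (K (U s y))

end

open MeasureTheory

/-! ### Functions on the half-line, truncated to the whole line -/

section HalfLine

variable {E : Type*} [NormedAddCommGroup E]

/-! Subtracting the Dirichlet lift, `(u, x) ↦ (u - E x, x)`, turns the coupling `L u = x` into `u -
E x ∈ ker L`, and conjugates the matrix to the triangular one with entries `A₀`, `K`, `D` and
diagonal domain (`mem_graph_toOperator_iff`). The triangular matrix generates the semigroup whose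
corner is the convolution `S(t)`; conjugating back adds `E U(t) - T(t) E`. The semigroup law is the
cocycle identity `conv_add`, and the generator is found from the difference quotients
(`tendsto_coupledSemigroup_iff`).

For the asymptotics, exponential stability of `T` makes its operator norm integrable, so convolution
preserves boundedness. It also makes `S(t) y` asymptotic to `∫₀^∞ T(r) g(t - r) dr` whenever `g` is
bounded, continuous and asymptotic to `K U(t) y` (`tendsto_conv_sub_fullConv`). This full
convolution commutes with translations, hence preserves almost periodicity; for constant `g = K z`
it equals `-A₀⁻¹ K z`. A limit `z` of an orbit of `U` satisfies `D z = 0`, so `K z = B z`. -/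

theorem continuous_comp_max {f : ℝ → E} (hf : ContinuousOn f (Ici 0)) :
    Continuous fun s => f (max s 0) :=
  hf.comp_continuous (by fun_prop) fun _ => mem_Ici.2 (le_max_right _ _)

end HalfLine

/-! ### Finite convolutions with a bounded semigroup -/

section Semigroup

variable {E : Type*} [NormedAddCommGroup E] [NormedSpace ℂ E]

/-- Joint continuity of a bounded semigroup, extended by the identity to negative times. -/
theorem C0Semigroup.continuous_uncurry (T : C0Semigroup E) {M : ℝ}
    (hM : ∀ t, 0 ≤ t → ‖T t‖ ≤ M) : Continuous fun p : ℝ × E => T (max p.1 0) p.2 := by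
  refine continuous_iff_continuousAt.2 fun p₀ => ?_
  -- Split `T(s) x = T(s)(x - x₀) + T(s) x₀`: the uniform bound controls the first term, strong
  -- continuity the second.
  have h₁ : Tendsto (fun p : ℝ × E => T (max p.1 0) (p.2 - p₀.2)) (𝓝 p₀) (𝓝 0) := by
    have h₂ : Tendsto (fun p : ℝ × E => M * ‖p.2 - p₀.2‖) (𝓝 p₀) (𝓝 0) := by
      have : Continuous fun p : ℝ × E => M * ‖p.2 - p₀.2‖ := by fun_prop
      simpa using this.tendsto p₀
    exact squeeze_zero_norm
      (fun p => (T (max p.1 0)).le_of_opNorm_le (hM _ (le_max_right _ _)) _) h₂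
  have h₃ : Continuous fun p : ℝ × E => T (max p.1 0) p₀.2 :=
    (T.continuousOn_orbit p₀.2).comp_continuous (by fun_prop) fun _ => mem_Ici.2 (le_max_right _ _)
  have h₄ := h₁.add (h₃.tendsto p₀)
  simp only [map_sub, sub_add_cancel, zero_add] at h₄
  exact h₄

/-- Uniform boundedness principle. It serves the boundary semigroup, for which no global bound is
assumed. -/
theorem C0Semigroup.exists_bound_Icc [CompleteSpace E] (T : C0Semigroup E) (t : ℝ) :
    ∃ N, 0 ≤ N ∧ ∀ s ∈ Icc 0 t, ‖T s‖ ≤ N := by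
  obtain ⟨N, hN⟩ := banach_steinhaus (g := fun s : Icc 0 t => T s) fun x => by
    obtain ⟨c, hc⟩ := isCompact_Icc.exists_bound_of_continuousOn
      ((T.continuousOn_orbit x).mono (Icc_subset_Ici_self : Icc 0 t ⊆ Ici 0))
    exact ⟨c, fun s => hc s s.2⟩
  exact ⟨max N 0, le_max_right _ _, fun s hs => (hN ⟨s, hs⟩).trans (le_max_left _ _)⟩

/-- The convolution `∫₀ᵗ T(t - s) f(s) ds`. -/
noncomputable def C0Semigroup.conv (T : C0Semigroup E) (f : ℝ → E) (t : ℝ) : E :=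
  ∫ s in (0 : ℝ)..t, T (t - s) (f s)

/-- Substituting `r = t - s` moves `t` into the argument of `f`; the truncations make the integrand
jointly continuous on the plane. -/
theorem C0Semigroup.conv_eq (T : C0Semigroup E) (f : ℝ → E) {t : ℝ} (ht : 0 ≤ t) :
    T.conv f t = ∫ r in (0 : ℝ)..t, T (max r 0) (f (max (t - r) 0)) := by
  have h := intervalIntegral.integral_comp_sub_left (a := 0) (b := t)
    (fun r => T r (f (t - r))) t
  simp only [sub_sub_cancel, sub_self, sub_zero] at h
  rw [C0Semigroup.conv, h]
  refine intervalIntegral.integral_congr fun r hr => ?_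
  rw [uIcc_of_le ht] at hr
  simp only [max_eq_left hr.1, max_eq_left (sub_nonneg.2 hr.2)]

theorem C0Semigroup.continuous_convIntegrand (T : C0Semigroup E) {M : ℝ}
    (hM : ∀ t, 0 ≤ t → ‖T t‖ ≤ M) {f : ℝ → E} (hf : ContinuousOn f (Ici 0)) :
    Continuous fun p : ℝ × ℝ => T (max p.2 0) (f (max (p.1 - p.2) 0)) :=
  (T.continuous_uncurry hM).comp
    (continuous_snd.prodMk ((continuous_comp_max hf).comp (continuous_fst.sub continuous_snd)))

theorem C0Semigroup.intervalIntegrable_conv (T : C0Semigroup E) {M : ℝ}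
    (hM : ∀ t, 0 ≤ t → ‖T t‖ ≤ M) {f : ℝ → E} (hf : ContinuousOn f (Ici 0)) {a b t : ℝ}
    (ha : 0 ≤ a) (hat : a ≤ t) (hb : 0 ≤ b) (hbt : b ≤ t) :
    IntervalIntegrable (fun s => T (t - s) (f s)) volume a b := by
  have h : Continuous fun s => T (max (t - s) 0) (f (max s 0)) :=
    (T.continuous_uncurry hM).comp
      ((continuous_const.sub continuous_id).prodMk (continuous_comp_max hf))
  refine (h.intervalIntegrable a b).congr fun s hs => ?_
  have hs' := uIoc_subset_uIcc hs
  rw [mem_uIcc] at hs'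
  have h0 : 0 ≤ s := by rcases hs' with h | h <;> linarith
  have h1 : 0 ≤ t - s := by rcases hs' with h | h <;> linarith
  simp only [max_eq_left h0, max_eq_left h1]

theorem C0Semigroup.continuousOn_conv (T : C0Semigroup E) {M : ℝ}
    (hM : ∀ t, 0 ≤ t → ‖T t‖ ≤ M) {f : ℝ → E} (hf : ContinuousOn f (Ici 0)) :
    ContinuousOn (T.conv f) (Ici 0) := by
  have h : Continuous fun t : ℝ => ∫ r in (0 : ℝ)..t, T (max r 0) (f (max (t - r) 0)) :=
    intervalIntegral.continuous_parametric_intervalIntegral_of_continuous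
      (f := fun t r => T (max r 0) (f (max (t - r) 0)))
      (T.continuous_convIntegrand hM hf) continuous_id
  exact h.continuousOn.congr fun t ht => T.conv_eq f ht

/-- The right derivative of the convolution at `0` is `f 0`. -/
theorem C0Semigroup.tendsto_conv_div (T : C0Semigroup E) [CompleteSpace E] {M : ℝ}
    (hM : ∀ t, 0 ≤ t → ‖T t‖ ≤ M) {f : ℝ → E} (hf : ContinuousOn f (Ici 0)) :
    Tendsto (fun t : ℝ => t⁻¹ • T.conv f t) (𝓝[>] 0) (𝓝 (f 0)) := by
  have hc := T.continuous_convIntegrand hM hf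
  rw [Metric.tendsto_nhds]
  intro ε hε
  -- At the origin the integrand is `f 0`; `ε / 2` restores the strict inequality lost in
  -- integrating.
  obtain ⟨δ, hδ, h⟩ := Metric.continuousAt_iff.1 (hc.continuousAt (x := (0, 0))) (ε / 2) (half_pos hε)
  filter_upwards [Ioo_mem_nhdsGT hδ] with t ht
  have ht0 : 0 < t := ht.1
  have hint : IntervalIntegrable (fun r => T (max r 0) (f (max (t - r) 0))) volume 0 t :=
    (hc.comp (continuous_const.prodMk continuous_id)).intervalIntegrable _ _
  have hle : ‖∫ r in (0 : ℝ)..t, (T (max r 0) (f (max (t - r) 0)) - f 0)‖ ≤ ε / 2 * |t - 0| := by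
    refine intervalIntegral.norm_integral_le_of_norm_le_const fun r hr => ?_
    rw [uIoc_of_le ht0.le] at hr
    have hd : dist (t, r) ((0 : ℝ), (0 : ℝ)) < δ := by
      rw [Prod.dist_eq, max_lt_iff]
      simp only [Real.dist_eq, sub_zero, abs_of_pos ht0, abs_of_pos hr.1]
      exact ⟨ht.2, hr.2.trans_lt ht.2⟩
    have := h hd
    simp only [max_self, sub_self, T.map_zero, ContinuousLinearMap.id_apply, dist_eq_norm] at this
    exact this.le
  rw [intervalIntegral.integral_sub hint intervalIntegrable_const, intervalIntegral.integral_const,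
    ← T.conv_eq f ht0.le, sub_zero, abs_of_pos ht0] at hle
  have heq : t⁻¹ • T.conv f t - f 0 = t⁻¹ • (T.conv f t - t • f 0) := by
    rw [smul_sub, smul_smul, inv_mul_cancel₀ ht0.ne', one_smul]
  rw [dist_eq_norm, heq, norm_smul, norm_inv, Real.norm_eq_abs, abs_of_pos ht0]
  calc t⁻¹ * ‖T.conv f t - t • f 0‖ ≤ t⁻¹ * (ε / 2 * t) := by gcongr
    _ = ε / 2 := by field_simp
    _ < ε := half_lt_self hε

/-- The cocycle identity of the convolution. -/
theorem C0Semigroup.conv_add (T : C0Semigroup E) [CompleteSpace E] {M : ℝ}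
    (hM : ∀ t, 0 ≤ t → ‖T t‖ ≤ M) {f : ℝ → E} (hf : ContinuousOn f (Ici 0)) {s t : ℝ}
    (hs : 0 ≤ s) (ht : 0 ≤ t) :
    T.conv f (s + t) = T s (T.conv f t) + T.conv (fun r => f (r + t)) s := by
  have h₁ : ∫ r in (0 : ℝ)..t, T (s + t - r) (f r) = T s (T.conv f t) := by
    rw [C0Semigroup.conv, ← ContinuousLinearMap.intervalIntegral_comp_comm _
      (T.intervalIntegrable_conv hM hf le_rfl ht ht le_rfl)]
    refine intervalIntegral.integral_congr fun r hr => ?_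
    rw [uIcc_of_le ht] at hr
    simp only [add_sub_assoc, T.map_add s (t - r) hs (sub_nonneg.2 hr.2),
      ContinuousLinearMap.comp_apply]
  have h₂ : ∫ r in t..(s + t), T (s + t - r) (f r) = T.conv (fun r => f (r + t)) s := by
    have := intervalIntegral.integral_comp_add_right (a := 0) (b := s)
      (fun r => T (s + t - r) (f r)) t
    rw [zero_add] at this
    rw [← this, C0Semigroup.conv]
    simp only [add_sub_add_right_eq_sub]
  rw [← h₁, ← h₂, intervalIntegral.integral_add_adjacent_intervals]
  · rfl
  · exact T.intervalIntegrable_conv hM hf le_rfl (by linarith) ht (by linarith)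
  · exact T.intervalIntegrable_conv hM hf ht (by linarith) (by linarith) le_rfl

end Semigroup

/-! ### Convolutions with an exponentially stable semigroup -/

section Stable

variable {E : Type*} [NormedAddCommGroup E] [NormedSpace ℂ E] {T : C0Semigroup E} {M ε : ℝ}

theorem C0Semigroup.const_nonneg (hM : ∀ t, 0 ≤ t → ‖T t‖ ≤ M * Real.exp (-ε * t)) : 0 ≤ M := by
  have := (norm_nonneg _).trans (hM 0 le_rfl)
  simpa using this

theorem C0Semigroup.norm_le_const (hε : 0 < ε)
    (hM : ∀ t, 0 ≤ t → ‖T t‖ ≤ M * Real.exp (-ε * t)) (t : ℝ) (ht : 0 ≤ t) : ‖T t‖ ≤ M := by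
  refine (hM t ht).trans (mul_le_of_le_one_right (C0Semigroup.const_nonneg hM) ?_)
  rw [Real.exp_le_one_iff]
  nlinarith

theorem C0Semigroup.tendsto_atTop_zero (hε : 0 < ε)
    (hM : ∀ t, 0 ≤ t → ‖T t‖ ≤ M * Real.exp (-ε * t)) (x : E) :
    Tendsto (fun t => T t x) atTop (𝓝 0) := by
  have h : Tendsto (fun t => M * Real.exp (-ε * t) * ‖x‖) atTop (𝓝 0) := by
    have : Tendsto (fun t => Real.exp (-ε * t)) atTop (𝓝 0) :=
      Real.tendsto_exp_atBot.comp (tendsto_id.const_mul_atTop_of_neg (neg_neg_of_pos hε))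
    simpa using (this.const_mul M).mul_const ‖x‖
  refine squeeze_zero_norm' ?_ h
  filter_upwards [eventually_ge_atTop 0] with t ht
  exact (T t).le_of_opNorm_le (hM t ht) x

theorem norm_apply_max_le (hM : ∀ t, 0 ≤ t → ‖T t‖ ≤ M * Real.exp (-ε * t)) {r N : ℝ}
    (hr : 0 < r) {x : E} (hx : ‖x‖ ≤ N) :
    ‖T (max r 0) x‖ ≤ M * Real.exp (-ε * r) * N := by
  rw [max_eq_left hr.le]
  exact ((T r).le_of_opNorm_le (hM r hr.le) x).trans
    (mul_le_mul_of_nonneg_left hx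
      (mul_nonneg (C0Semigroup.const_nonneg hM) (Real.exp_pos _).le))

theorem integrableOn_exp_bound (hε : 0 < ε) (M N : ℝ) :
    IntegrableOn (fun r => M * Real.exp (-ε * r) * N) (Ioi 0) :=
  ((exp_neg_integrableOn_Ioi 0 hε).const_mul M).mul_const N

theorem C0Semigroup.bounded_conv (hε : 0 < ε)
    (hM : ∀ t, 0 ≤ t → ‖T t‖ ≤ M * Real.exp (-ε * t)) {f : ℝ → E}
    (hf : BoundedOnHalfLine f) : BoundedOnHalfLine (T.conv f) := by
  obtain ⟨N, hN⟩ := hf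
  have hN0 : 0 ≤ N := (norm_nonneg _).trans (hN 0 le_rfl)
  refine ⟨∫ r in Ioi (0 : ℝ), M * Real.exp (-ε * r) * N, fun t ht => ?_⟩
  rw [T.conv_eq f ht, intervalIntegral.integral_of_le ht]
  have hi := integrableOn_exp_bound hε M N
  refine (norm_integral_le_of_norm_le (hi.mono_set Ioc_subset_Ioi_self) ?_).trans
    (setIntegral_mono_set hi ?_ Ioc_subset_Ioi_self.eventuallyLE)
  · exact (ae_restrict_iff' measurableSet_Ioc).2 (ae_of_all _ fun r hr =>
      norm_apply_max_le hM hr.1 (hN _ (le_max_right _ _)))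
  · exact ae_of_all _ fun r =>
      mul_nonneg (mul_nonneg (C0Semigroup.const_nonneg hM) (Real.exp_pos _).le) hN0

/-- The convolution over the whole half-line, `∫₀^∞ T(r) g(t - r) dr`. -/
noncomputable def C0Semigroup.fullConv (T : C0Semigroup E) (g : ℝ → E) (t : ℝ) : E :=
  ∫ r in Ioi (0 : ℝ), T (max r 0) (g (t - r))

theorem C0Semigroup.continuous_fullConvIntegrand (hε : 0 < ε)
    (hM : ∀ t, 0 ≤ t → ‖T t‖ ≤ M * Real.exp (-ε * t)) {g : ℝ → E} (hg : Continuous g) :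
    Continuous fun p : ℝ × ℝ => T (max p.2 0) (g (p.1 - p.2)) :=
  (T.continuous_uncurry (C0Semigroup.norm_le_const hε hM)).comp
    (continuous_snd.prodMk (hg.comp (continuous_fst.sub continuous_snd)))

theorem C0Semigroup.integrableOn_fullConvIntegrand (hε : 0 < ε)
    (hM : ∀ t, 0 ≤ t → ‖T t‖ ≤ M * Real.exp (-ε * t)) {g : ℝ → E} (hg : Continuous g) {N : ℝ}
    (hN : ∀ t, ‖g t‖ ≤ N) (t : ℝ) :
    IntegrableOn (fun r => T (max r 0) (g (t - r))) (Ioi 0) := by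
  refine (integrableOn_exp_bound hε M N).mono'
    ((C0Semigroup.continuous_fullConvIntegrand hε hM hg).comp
      (continuous_const.prodMk continuous_id)).aestronglyMeasurable ?_
  exact (ae_restrict_iff' measurableSet_Ioi).2 (ae_of_all _ fun r hr =>
    norm_apply_max_le hM hr (hN _))

theorem C0Semigroup.continuous_fullConv (hε : 0 < ε)
    (hM : ∀ t, 0 ≤ t → ‖T t‖ ≤ M * Real.exp (-ε * t)) {g : ℝ → E} (hg : Continuous g) {N : ℝ}
    (hN : ∀ t, ‖g t‖ ≤ N) : Continuous (T.fullConv g) := by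
  have hc := C0Semigroup.continuous_fullConvIntegrand hε hM hg
  refine continuous_of_dominated (bound := fun r => M * Real.exp (-ε * r) * N)
    (fun t => (hc.comp (continuous_const.prodMk continuous_id)).aestronglyMeasurable)
    (fun t => ?_) (integrableOn_exp_bound hε M N)
    (ae_of_all _ fun r => hc.comp (continuous_id.prodMk continuous_const))
  exact (ae_restrict_iff' measurableSet_Ioi).2 (ae_of_all _ fun r hr =>
    norm_apply_max_le hM hr (hN _))

/-- Full convolution commutes with translation, so every `δ`-period of `g` survives up to the
integral of the exponential bound. -/
theorem C0Semigroup.norm_fullConv_sub_le (hε : 0 < ε)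
    (hM : ∀ t, 0 ≤ t → ‖T t‖ ≤ M * Real.exp (-ε * t)) {g : ℝ → E} (hg : Continuous g) {N : ℝ}
    (hN : ∀ t, ‖g t‖ ≤ N) {τ δ : ℝ} (h : ∀ t, ‖g (t + τ) - g t‖ ≤ δ) (t : ℝ) :
    ‖T.fullConv g (t + τ) - T.fullConv g t‖ ≤
      (∫ r in Ioi (0 : ℝ), M * Real.exp (-ε * r)) * δ := by
  rw [C0Semigroup.fullConv, C0Semigroup.fullConv, ← integral_sub
    (C0Semigroup.integrableOn_fullConvIntegrand hε hM hg hN _)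
    (C0Semigroup.integrableOn_fullConvIntegrand hε hM hg hN _), ← integral_mul_const]
  refine norm_integral_le_of_norm_le (integrableOn_exp_bound hε M δ) ?_
  refine (ae_restrict_iff' measurableSet_Ioi).2 (ae_of_all _ fun r hr => ?_)
  rw [← map_sub]
  refine norm_apply_max_le hM hr ?_
  rw [show t + τ - r = t - r + τ by ring]
  exact h _

/-- Convolutions of asymptotically equal functions are asymptotically equal. -/
theorem C0Semigroup.tendsto_conv_sub_fullConv (hε : 0 < ε)
    (hM : ∀ t, 0 ≤ t → ‖T t‖ ≤ M * Real.exp (-ε * t)) {f g : ℝ → E}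
    (hf : ContinuousOn f (Ici 0)) (hfb : BoundedOnHalfLine f)
    (hg : Continuous g) {N : ℝ} (hN : ∀ t, ‖g t‖ ≤ N)
    (hfg : Tendsto (fun t => f t - g t) atTop (𝓝 0)) :
    Tendsto (fun t => T.conv f t - T.fullConv g t) atTop (𝓝 0) := by
  obtain ⟨N', hN'⟩ := hfb
  have hN0 : 0 ≤ N' := (norm_nonneg _).trans (hN' 0 le_rfl)
  have hcf := T.continuous_convIntegrand (C0Semigroup.norm_le_const hε hM) hf
  have hcg := C0Semigroup.continuous_fullConvIntegrand hε hM hg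
  have hmf (t : ℝ) : Continuous fun r => T (max r 0) (f (max (t - r) 0)) :=
    hcf.comp (continuous_const.prodMk continuous_id)
  have hmg (t : ℝ) : Continuous fun r => T (max r 0) (g (t - r)) :=
    hcg.comp (continuous_const.prodMk continuous_id)
  -- Extension by zero beyond `t` puts both convolutions on one half-line. For fixed `r`, once `t ≥
  -- r`, the integrands differ by `T(r) (f(t - r) - g(t - r))`, and dominated convergence applies.
  let F (t r : ℝ) : E := (Iic t).indicator (fun r => T (max r 0) (f (max (t - r) 0))) r
  have hFm (t : ℝ) : AEStronglyMeasurable (F t) (volume.restrict (Ioi 0)) :=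
    ((hmf t).stronglyMeasurable.indicator measurableSet_Iic).aestronglyMeasurable
  have hFb (t r : ℝ) (hr : 0 < r) : ‖F t r‖ ≤ M * Real.exp (-ε * r) * N' :=
    (norm_indicator_le_norm_self _ _).trans (norm_apply_max_le hM hr (hN' _ (le_max_right _ _)))
  have key : Tendsto (fun t => ∫ r in Ioi (0 : ℝ), (F t r - T (max r 0) (g (t - r))))
      atTop (𝓝 (∫ _ in Ioi (0 : ℝ), (0 : E))) := by
    refine tendsto_integral_filter_of_dominated_convergence
      (fun r => M * Real.exp (-ε * r) * N' + M * Real.exp (-ε * r) * N)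
      (Eventually.of_forall fun t => (hFm t).sub (hmg t).aestronglyMeasurable)
      (Eventually.of_forall fun t => ?_)
      ((integrableOn_exp_bound hε M N').add (integrableOn_exp_bound hε M N))
      ((ae_restrict_iff' measurableSet_Ioi).2 (ae_of_all _ fun r hr => ?_))
    · exact (ae_restrict_iff' measurableSet_Ioi).2 (ae_of_all _ fun r hr =>
        (norm_sub_le _ _).trans (add_le_add (hFb t r hr) (norm_apply_max_le hM hr (hN _))))
    · have hlim : Tendsto (fun t => T (max r 0) (f (t - r) - g (t - r))) atTop (𝓝 0) := by
        have := ((T (max r 0)).continuous.tendsto 0).comp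
          (hfg.comp (tendsto_atTop_add_const_right _ (-r) tendsto_id))
        simpa [Function.comp_def, ← sub_eq_add_neg] using this
      refine hlim.congr' ?_
      filter_upwards [eventually_ge_atTop r] with t ht
      simp only [F]
      rw [indicator_of_mem (mem_Iic.2 ht), max_eq_left (sub_nonneg.2 ht), map_sub]
  rw [integral_zero] at key
  refine key.congr' ?_
  filter_upwards [eventually_ge_atTop 0] with t ht
  rw [integral_sub ((integrableOn_exp_bound hε M N').mono' (hFm t) ?_)
    (C0Semigroup.integrableOn_fullConvIntegrand hε hM hg hN t)]
  · rw [setIntegral_indicator measurableSet_Iic, Ioi_inter_Iic,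
      ← intervalIntegral.integral_of_le ht, ← T.conv_eq f ht]
    rfl
  · exact (ae_restrict_iff' measurableSet_Ioi).2 (ae_of_all _ fun r hr => hFb t r hr)

/-- `∫₀^∞ T(r) G x dr = -x` for the generator `G` of a uniformly exponentially stable semigroup. -/
theorem C0Semigroup.fullConv_const [CompleteSpace E] (hε : 0 < ε)
    (hM : ∀ t, 0 ≤ t → ‖T t‖ ≤ M * Real.exp (-ε * t)) {G : E →ₗ.[ℂ] E} (hG : IsGenerator T G)
    {x z : E} (hx : (x, z) ∈ G.graph) (t : ℝ) : T.fullConv (fun _ => z) t = -x := by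
  have hi := C0Semigroup.integrableOn_fullConvIntegrand hε hM
    (continuous_const (y := z)) (fun _ => le_rfl) t
  have hcont : Continuous fun r => T (max r 0) z :=
    (T.continuous_uncurry (C0Semigroup.norm_le_const hε hM)).comp
      (continuous_id.prodMk continuous_const)
  have h₁ := intervalIntegral_tendsto_integral_Ioi 0 hi tendsto_id
  have h₂ : Tendsto (fun t => T t x - x) atTop (𝓝 (0 - x)) :=
    (C0Semigroup.tendsto_atTop_zero hε hM x).sub_const x
  rw [zero_sub] at h₂
  refine tendsto_nhds_unique (h₁.congr' ?_) h₂
  filter_upwards [eventually_ge_atTop 0] with b hb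
  -- The generator supplies only a right derivative of the orbit, `T(r) z`; with continuity this
  -- suffices for the fundamental theorem of calculus.
  have := intervalIntegral.integral_eq_sub_of_hasDeriv_right (a := 0) (b := b)
    (f := fun r => T r x) (f' := fun r => T (max r 0) z)
    ((T.continuousOn_orbit x).mono (by rw [uIcc_of_le hb]; exact Icc_subset_Ici_self))
    (fun r hr => ?_) (hcont.intervalIntegrable _ _)
  · rw [id, this, T.map_zero, ContinuousLinearMap.id_apply]
  · have hr0 : 0 < r := by simpa [min_eq_left hb] using hr.1
    rw [max_eq_left hr0.le, hasDerivWithinAt_iff_tendsto_slope' (by simp)]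
    have h := ((T r).continuous.tendsto z).comp ((hG x z).1 hx)
    have hs : Tendsto (fun q : ℝ => q - r) (𝓝[>] r) (𝓝[>] 0) := by
      refine tendsto_nhdsWithin_iff.2 ⟨?_, eventually_mem_nhdsWithin.mono fun q hq => mem_Ioi.2 (sub_pos.2 hq)⟩
      exact ((continuous_sub_right r).tendsto' r 0 (sub_self r)).mono_left nhdsWithin_le_nhds
    refine (h.comp hs).congr' ?_
    filter_upwards [self_mem_nhdsWithin] with q hq
    have hq' : (0 : ℝ) ≤ q - r := (sub_pos.2 hq).le
    have hsum := T.map_add r (q - r) hr0.le hq'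
    rw [add_sub_cancel] at hsum
    simp only [Function.comp_def, slope_def_module, hsum, ContinuousLinearMap.comp_apply]
    rw [← map_sub, (T r).map_smul_of_tower]

end Stable

/-! ### Almost periodic and convergent functions -/

section AlmostPeriodic

variable {E F : Type*} [NormedAddCommGroup E] [NormedAddCommGroup F]

/-- A `1`-period moves any point into the compact interval `[0, l]`. -/
theorem AlmostPeriodic.bounded {g : ℝ → E} (hg : AlmostPeriodic g) : ∃ N, ∀ t, ‖g t‖ ≤ N := by
  obtain ⟨l, -, hl⟩ := hg.2 1 one_pos
  obtain ⟨c, hc⟩ := isCompact_Icc.exists_bound_of_continuousOn (hg.1.continuousOn (s := Icc 0 l))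
  refine ⟨c + 1, fun t => ?_⟩
  obtain ⟨τ, hτ, h⟩ := hl (-t)
  have h₁ := hc (t + τ) ⟨by linarith [hτ.1], by linarith [hτ.2]⟩
  have h₂ := norm_sub_norm_le (g t) (g (t + τ))
  rw [norm_sub_rev] at h₂
  linarith [h t]

theorem bounded_of_tendsto_atTop {f : ℝ → E} (hf : ContinuousOn f (Ici 0)) {z : E}
    (hz : Tendsto f atTop (𝓝 z)) : BoundedOnHalfLine f := by
  obtain ⟨a, ha⟩ := eventually_atTop.1 (hz.norm.eventually_le_const (lt_add_one ‖z‖))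
  obtain ⟨c, hc⟩ := isCompact_Icc.exists_bound_of_continuousOn
    (hf.mono (Icc_subset_Ici_self : Icc 0 a ⊆ Ici 0))
  refine ⟨max c (‖z‖ + 1), fun t ht => ?_⟩
  rcases le_total t a with h | h
  · exact (hc t ⟨ht, h⟩).trans (le_max_left _ _)
  · exact (ha t h).trans (le_max_right _ _)

/-- A continuous function whose translation differences are controlled by those of an almost
periodic function is almost periodic. -/
theorem AlmostPeriodic.of_norm_sub_le {g : ℝ → E} (hg : AlmostPeriodic g) {φ : ℝ → F}
    (hφ : Continuous φ) {c : ℝ} (hc : 0 ≤ c)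
    (h : ∀ τ δ : ℝ, (∀ t, ‖g (t + τ) - g t‖ ≤ δ) → ∀ t, ‖φ (t + τ) - φ t‖ ≤ c * δ) :
    AlmostPeriodic φ := by
  refine ⟨hφ, fun ε hε => ?_⟩
  have hc' : 0 < c + 1 := by linarith
  -- Dividing by `c + 1` covers `c = 0`.
  obtain ⟨l, hl, hl'⟩ := hg.2 (ε / (c + 1)) (div_pos hε hc')
  refine ⟨l, hl, fun a => ?_⟩
  obtain ⟨τ, hτ, ht⟩ := hl' a
  refine ⟨τ, hτ, fun t => (h τ _ ht t).trans ?_⟩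
  rw [mul_div_assoc', div_le_iff₀ hc']
  nlinarith

end AlmostPeriodic

/-! ### The coupled semigroup and its asymptotics -/

section Coupled

variable {X Y : Type*} [NormedAddCommGroup X] [NormedSpace ℂ X]
  [NormedAddCommGroup Y] [NormedSpace ℂ Y] {T : C0Semigroup X} {U : C0Semigroup Y} {M ε : ℝ}
  (K E : Y →L[ℂ] X)

theorem continuousOn_clm_orbit (U : C0Semigroup Y) (K : Y →L[ℂ] X) (y : Y) :
    ContinuousOn (fun s => K (U s y)) (Ici 0) :=
  K.continuous.comp_continuousOn (U.continuousOn_orbit y)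

theorem BoundedOnHalfLine.clm_comp {f : ℝ → Y} (hf : BoundedOnHalfLine f) :
    BoundedOnHalfLine fun t => K (f t) := by
  obtain ⟨N, hN⟩ := hf
  exact ⟨‖K‖ * N, fun t ht => K.le_opNorm_of_le (hN t ht)⟩

/-- Boundedness of `S(t) y + E U(t) y - T(t) x`. -/
theorem bounded_coupling (hε : 0 < ε) (hM : ∀ t, 0 ≤ t → ‖T t‖ ≤ M * Real.exp (-ε * t)) (x : X)
    {y : Y} (hy : BoundedOnHalfLine fun t => U t y) :
    BoundedOnHalfLine fun t => convolutionOp T K U t y + E (U t y) - T t x := by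
  obtain ⟨N₁, h₁⟩ := C0Semigroup.bounded_conv hε hM (hy.clm_comp K)
  obtain ⟨N₂, h₂⟩ := hy.clm_comp E
  refine ⟨N₁ + N₂ + M * ‖x‖, fun t ht => (norm_sub_le _ _).trans (add_le_add
    ((norm_add_le _ _).trans (add_le_add (h₁ t ht) (h₂ t ht)))
    ((T t).le_of_opNorm_le (C0Semigroup.norm_le_const hε hM t ht) x))⟩

/-- Asymptotic almost periodicity of `S(t) y + E U(t) y - T(t) x`. -/
theorem asymptoticallyAlmostPeriodic_coupling (hε : 0 < ε)
    (hM : ∀ t, 0 ≤ t → ‖T t‖ ≤ M * Real.exp (-ε * t)) (x : X)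
    {y : Y} (hy : BoundedOnHalfLine fun t => U t y)
    (hy' : AsymptoticallyAlmostPeriodic fun t => U t y) :
    AsymptoticallyAlmostPeriodic fun t => convolutionOp T K U t y + E (U t y) - T t x := by
  obtain ⟨g, h, hg, hh, hh0, hgh⟩ := hy'
  obtain ⟨N, hN⟩ := hg.bounded
  have hKg : Continuous fun t => K (g t) := K.continuous.comp hg.1
  have hKN (t : ℝ) : ‖K (g t)‖ ≤ ‖K‖ * N := K.le_opNorm_of_le (hN t)
  have hφ : Continuous fun t => T.fullConv (fun s => K (g s)) t + E (g t) :=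
    (C0Semigroup.continuous_fullConv hε hM hKg hKN).add (E.continuous.comp hg.1)
  have hI : 0 ≤ ∫ r in Ioi (0 : ℝ), M * Real.exp (-ε * r) :=
    integral_nonneg fun r => mul_nonneg (C0Semigroup.const_nonneg hM) (Real.exp_pos _).le
  refine ⟨fun t => T.fullConv (fun s => K (g s)) t + E (g t),
    fun t => convolutionOp T K U t y + E (U t y) - T t x -
      (T.fullConv (fun s => K (g s)) t + E (g t)),
    hg.of_norm_sub_le hφ
      (c := (∫ r in Ioi (0 : ℝ), M * Real.exp (-ε * r)) * ‖K‖ + ‖E‖) (by positivity) ?_,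
    ?_, ?_, fun t _ => (add_sub_cancel _ _).symm⟩
  · intro τ δ hδ t
    have h₁ := C0Semigroup.norm_fullConv_sub_le (τ := τ) (δ := ‖K‖ * δ) hε hM hKg hKN
      (fun t => by rw [← map_sub]; exact K.le_opNorm_of_le (hδ t)) t
    have h₂ : ‖E (g (t + τ)) - E (g t)‖ ≤ ‖E‖ * δ := by
      rw [← map_sub]; exact E.le_opNorm_of_le (hδ t)
    rw [add_sub_add_comm]
    refine (norm_add_le_of_le h₁ h₂).trans_eq ?_
    ring
  · exact (((T.continuousOn_conv (C0Semigroup.norm_le_const hε hM)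
      (continuousOn_clm_orbit U K y)).add (continuousOn_clm_orbit U E y)).sub
      (T.continuousOn_orbit x)).sub hφ.continuousOn
  · have hUg : Tendsto (fun t => U t y - g t) atTop (𝓝 0) := by
      refine hh0.congr' ?_
      filter_upwards [eventually_ge_atTop 0] with t ht
      exact (sub_eq_of_eq_add' (hgh t ht)).symm
    have hK := (K.continuous.tendsto 0).comp hUg
    have hE := (E.continuous.tendsto 0).comp hUg
    simp only [Function.comp_def, map_sub, map_zero] at hK hE
    have h₁ := C0Semigroup.tendsto_conv_sub_fullConv hε hM (continuousOn_clm_orbit U K y)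
      (hy.clm_comp K) hKg hKN hK
    have h₂ := (h₁.add hE).sub (C0Semigroup.tendsto_atTop_zero hε hM x)
    simp only [add_zero, sub_zero] at h₂
    refine h₂.congr fun t => ?_
    change _ = T.conv (fun s => K (U s y)) t + _ - _ - _
    abel

/-- The limit of `S(t) y + E U(t) y - T(t) x`. -/
theorem tendsto_coupling [CompleteSpace X] (hε : 0 < ε)
    (hM : ∀ t, 0 ≤ t → ‖T t‖ ≤ M * Real.exp (-ε * t)) {G : X →ₗ.[ℂ] X} (hG : IsGenerator T G)
    (x : X) {y z : Y} (hy : Tendsto (fun t => U t y) atTop (𝓝 z)) {v : X}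
    (hv : (v, K z) ∈ G.graph) :
    Tendsto (fun t => convolutionOp T K U t y + E (U t y) - T t x) atTop (𝓝 (E z - v)) := by
  have hK := (((K.continuous.tendsto z).comp hy).sub_const (K z))
  rw [sub_self] at hK
  have h₁ := C0Semigroup.tendsto_conv_sub_fullConv hε hM (continuousOn_clm_orbit U K y)
    ((bounded_of_tendsto_atTop (U.continuousOn_orbit y) hy).clm_comp K) continuous_const
    (fun _ => le_rfl) hK
  simp only [C0Semigroup.fullConv_const hε hM hG hv] at h₁
  have h₂ := ((h₁.sub_const v).add ((E.continuous.tendsto z).comp hy)).sub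
    (C0Semigroup.tendsto_atTop_zero hε hM x)
  rw [zero_sub, sub_zero, neg_add_eq_sub] at h₂
  refine h₂.congr fun t => ?_
  simp only [sub_neg_eq_add, add_sub_cancel_right]
  rfl

/-- Passing to the limit in `U(s + t) y = U(s) U(t) y` gives `U(s) z = z`, so all difference
quotients at `z` vanish. -/
theorem C0Semigroup.mem_graph_of_tendsto {G : Y →ₗ.[ℂ] Y} (hG : IsGenerator U G) {y z : Y}
    (hy : Tendsto (fun t => U t y) atTop (𝓝 z)) : (z, 0) ∈ G.graph := by
  rw [hG]
  refine tendsto_const_nhds.congr' ?_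
  filter_upwards [self_mem_nhdsWithin] with s hs
  have hs' : 0 < s := hs
  have h₁ : Tendsto (fun t => U (s + t) y) atTop (𝓝 z) :=
    hy.comp (tendsto_atTop_add_const_left _ s tendsto_id)
  have h₂ : Tendsto (fun t => U (s + t) y) atTop (𝓝 (U s z)) := by
    refine (((U s).continuous.tendsto z).comp hy).congr' ?_
    filter_upwards [eventually_ge_atTop 0] with t ht
    rw [U.map_add s t hs'.le ht, Function.comp_apply, ContinuousLinearMap.comp_apply]
  rw [tendsto_nhds_unique h₂ h₁, sub_self, smul_zero]

/-- Bounding the product of norms lets `c` depend on `t`: it is `M * N` for boundedness of `S(t)`,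
and an exponential in `t` for stability. -/
theorem norm_convolutionOp_le {t c : ℝ} (ht : 0 ≤ t) {y : Y}
    (h : ∀ s ∈ Icc 0 t, ‖T (t - s)‖ * ‖U s‖ ≤ c) :
    ‖convolutionOp T K U t y‖ ≤ c * ‖K‖ * ‖y‖ * t := by
  have := intervalIntegral.norm_integral_le_of_norm_le_const (a := 0) (b := t)
    (f := fun s => T (t - s) (K (U s y))) (C := c * ‖K‖ * ‖y‖) fun s hs => ?_
  · rwa [sub_zero, abs_of_nonneg ht] at this
  · rw [uIoc_of_le ht] at hs
    calc ‖T (t - s) (K (U s y))‖ ≤ ‖T (t - s)‖ * (‖K‖ * (‖U s‖ * ‖y‖)) :=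
          (T (t - s)).le_opNorm_of_le (K.le_opNorm_of_le ((U s).le_opNorm y))
      _ = ‖T (t - s)‖ * ‖U s‖ * (‖K‖ * ‖y‖) := by ring
      _ ≤ c * (‖K‖ * ‖y‖) := by gcongr; exact h s ⟨hs.1.le, hs.2⟩
      _ = c * ‖K‖ * ‖y‖ := by ring

/-- The convolution operators are bounded. -/
theorem exists_clm_convolutionOp [CompleteSpace Y]
    (hM : ∀ t, 0 ≤ t → ‖T t‖ ≤ M) (U : C0Semigroup Y) (K : Y →L[ℂ] X) :
    ∃ S : ℝ → Y →L[ℂ] X, ∀ t, 0 ≤ t → ∀ y, S t y = convolutionOp T K U t y := by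
  have (t : ℝ) : ∃ S : Y →L[ℂ] X, 0 ≤ t → ∀ y, S y = convolutionOp T K U t y := by
    by_cases ht : 0 ≤ t
    · obtain ⟨N, hN0, hN⟩ := U.exists_bound_Icc t
      have hi (y : Y) := T.intervalIntegrable_conv hM (continuousOn_clm_orbit U K y)
        le_rfl ht ht le_rfl
      refine ⟨LinearMap.mkContinuous
        { toFun := convolutionOp T K U t
          map_add' := fun x y => ?_
          map_smul' := fun c y => ?_ } (M * N * ‖K‖ * t) fun y => ?_, fun _ y => rfl⟩
      · simp only [convolutionOp, map_add]
        exact intervalIntegral.integral_add (hi x) (hi y)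
      · simp only [convolutionOp, map_smul]
        exact intervalIntegral.integral_smul c _
      · refine (norm_convolutionOp_le K (c := M * N) ht fun s hs => ?_).trans_eq (by ring)
        have := hM _ (sub_nonneg.2 hs.2)
        exact mul_le_mul this (hN s hs) (norm_nonneg _) ((norm_nonneg _).trans this)
    · exact ⟨0, fun h => absurd h ht⟩
  choose S hS using this
  exact ⟨S, hS⟩

/-- The semigroup with matrix `(T(t), S(t) + E U(t) - T(t) E; 0, U(t))`. -/
theorem exists_coupledSemigroup [CompleteSpace X] [CompleteSpace Y]
    (hM : ∀ t, 0 ≤ t → ‖T t‖ ≤ M) (U : C0Semigroup Y) :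
    ∃ W : C0Semigroup (X × Y), ∀ t, 0 ≤ t → ∀ x y,
      W t (x, y) = (T t x + (convolutionOp T K U t y + E (U t y) - T t (E y)), U t y) := by
  obtain ⟨S, hS⟩ := exists_clm_convolutionOp hM U K
  let W (t : ℝ) : X × Y →L[ℂ] X × Y :=
    ((T t).comp (ContinuousLinearMap.fst ℂ X Y) +
      (S t + E.comp (U t) - (T t).comp E).comp (ContinuousLinearMap.snd ℂ X Y)).prod
      ((U t).comp (ContinuousLinearMap.snd ℂ X Y))
  have hW (t : ℝ) (ht : 0 ≤ t) (x : X) (y : Y) : W t (x, y) =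
      (T t x + (convolutionOp T K U t y + E (U t y) - T t (E y)), U t y) := by
    simp [W, hS t ht]
  refine ⟨⟨W, ?_, ?_, ?_⟩, hW⟩
  · refine ContinuousLinearMap.ext fun p => ?_
    obtain ⟨x, y⟩ := p
    rw [hW 0 le_rfl]
    simp [T.map_zero, U.map_zero, convolutionOp]
  · intro s t hs ht
    refine ContinuousLinearMap.ext fun p => ?_
    obtain ⟨x, y⟩ := p
    -- The cocycle identity gives the corner of the product; the two terms `T(s) E U(t) y` cancel.
    have hadd := T.conv_add hM (continuousOn_clm_orbit U K y) hs ht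
    have hshift : T.conv (fun r => K (U (r + t) y)) s = T.conv (fun r => K (U r (U t y))) s := by
      refine intervalIntegral.integral_congr fun r hr => ?_
      rw [uIcc_of_le hs] at hr
      simp only [U.map_add r t hr.1 ht, ContinuousLinearMap.comp_apply]
    rw [hshift] at hadd
    rw [ContinuousLinearMap.comp_apply, hW t ht, hW s hs, hW (s + t) (add_nonneg hs ht)]
    change (_ + (T.conv (fun r => K (U r y)) (s + t) + _ - _), _) =
      (T s (_ + (T.conv (fun r => K (U r y)) t + _ - _)) +
        (T.conv (fun r => K (U r (U t y))) s + _ - _), _)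
    rw [hadd, T.map_add s t hs ht, U.map_add s t hs ht]
    simp only [ContinuousLinearMap.comp_apply, map_add, map_sub]
    refine Prod.ext ?_ rfl
    simp only
    abel
  · rintro ⟨x, y⟩
    have h : ContinuousOn (fun t =>
        (T t x + (convolutionOp T K U t y + E (U t y) - T t (E y)), U t y)) (Ici 0) :=
      ((T.continuousOn_orbit x).add (((T.continuousOn_conv hM
        (continuousOn_clm_orbit U K y)).add (continuousOn_clm_orbit U E y)).sub
        (T.continuousOn_orbit (E y)))).prodMk (U.continuousOn_orbit y)
    exact h.congr fun t ht => hW t ht x y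

/-- The first component of the quotient is that of `T` at `u - E x`, plus `E` applied to that of `U`
at `x`, plus `t⁻¹ S(t) x`. The last always tends to `K x`, and the middle one to `E w` once the
second component converges; subtracting them gives both directions. -/
theorem tendsto_coupledSemigroup_iff [CompleteSpace X] (hM : ∀ t, 0 ≤ t → ‖T t‖ ≤ M)
    {W : C0Semigroup (X × Y)} (hW : ∀ t, 0 ≤ t → ∀ x y,
      W t (x, y) = (T t x + (convolutionOp T K U t y + E (U t y) - T t (E y)), U t y))
    (u v : X) (x w : Y) :
    Tendsto (fun t : ℝ => t⁻¹ • (W t (u, x) - (u, x))) (𝓝[>] 0) (𝓝 (v, w)) ↔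
      Tendsto (fun t : ℝ => t⁻¹ • (T t (u - E x) - (u - E x))) (𝓝[>] 0)
        (𝓝 (v - E w - K x)) ∧
      Tendsto (fun t : ℝ => t⁻¹ • (U t x - x)) (𝓝[>] 0) (𝓝 w) := by
  have hS : Tendsto (fun t : ℝ => t⁻¹ • convolutionOp T K U t x) (𝓝[>] 0) (𝓝 (K x)) := by
    have := T.tendsto_conv_div hM (continuousOn_clm_orbit U K x)
    rwa [U.map_zero] at this
  have hE (h : Tendsto (fun t : ℝ => t⁻¹ • (U t x - x)) (𝓝[>] 0) (𝓝 w)) :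
      Tendsto (fun t : ℝ => t⁻¹ • (E (U t x) - E x)) (𝓝[>] 0) (𝓝 (E w)) := by
    refine ((E.continuous.tendsto w).comp h).congr fun t => ?_
    rw [Function.comp_apply, E.map_smul_of_tower, map_sub]
  have hfst : (fun t : ℝ => (t⁻¹ • (W t (u, x) - (u, x))).1) =ᶠ[𝓝[>] 0] fun t =>
      t⁻¹ • (T t (u - E x) - (u - E x)) + t⁻¹ • (E (U t x) - E x) +
        t⁻¹ • convolutionOp T K U t x := by
    filter_upwards [self_mem_nhdsWithin] with t ht
    rw [hW t (le_of_lt ht), Prod.smul_fst, Prod.fst_sub, ← smul_add, ← smul_add, map_sub]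
    congr 1
    dsimp only
    abel
  have hsnd : (fun t : ℝ => (t⁻¹ • (W t (u, x) - (u, x))).2) =ᶠ[𝓝[>] 0] fun t =>
      t⁻¹ • (U t x - x) := by
    filter_upwards [self_mem_nhdsWithin] with t ht
    rw [hW t (le_of_lt ht), Prod.smul_snd, Prod.snd_sub]
  rw [Prod.tendsto_iff, tendsto_congr' hfst, tendsto_congr' hsnd]
  refine and_congr_left fun h => ⟨fun h₁ => ?_, fun h₁ => ?_⟩
  · have := (h₁.sub hS).sub (hE h)
    simp only [add_sub_cancel_right] at this
    rwa [sub_right_comm] at this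
  · have := (h₁.add (hE h)).add hS
    rwa [sub_right_comm, sub_add_cancel, sub_add_cancel] at this

/-- Exponential stability of the coupled semigroup. -/
theorem uniformlyExponentiallyStable_coupledSemigroup (hε : 0 < ε)
    (hM : ∀ t, 0 ≤ t → ‖T t‖ ≤ M * Real.exp (-ε * t)) (hU : UniformlyExponentiallyStable U)
    {W : C0Semigroup (X × Y)} (hW : ∀ t, 0 ≤ t → ∀ x y,
      W t (x, y) = (T t x + (convolutionOp T K U t y + E (U t y) - T t (E y)), U t y)) :
    UniformlyExponentiallyStable W := by
  obtain ⟨M', ε', hε', hM'⟩ := hU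
  have hM0 : 0 ≤ M := C0Semigroup.const_nonneg hM
  have hM0' : 0 ≤ M' := C0Semigroup.const_nonneg hM'
  -- Both semigroups decay at rate `2 * δ`. Their convolution picks up a factor `t`, absorbed by
  -- giving up half of the rate, since `δ * t ≤ exp (δ * t)`.
  obtain ⟨δ, hδ, hδε, hδε'⟩ : ∃ δ, 0 < δ ∧ 2 * δ ≤ ε ∧ 2 * δ ≤ ε' :=
    ⟨min ε ε' / 2, by positivity, by linarith [min_le_left ε ε'], by linarith [min_le_right ε ε']⟩
  have hexp {η t : ℝ} (h : 2 * δ ≤ η) (ht : 0 ≤ t) :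
      Real.exp (-η * t) ≤ Real.exp (-(2 * δ) * t) := by
    rw [Real.exp_le_exp]; nlinarith
  have hexp₂ {t : ℝ} (ht : 0 ≤ t) : Real.exp (-(2 * δ) * t) ≤ Real.exp (-δ * t) := by
    rw [Real.exp_le_exp]; nlinarith
  have hT {t : ℝ} (ht : 0 ≤ t) : ‖T t‖ ≤ M * Real.exp (-(2 * δ) * t) :=
    (hM t ht).trans (mul_le_mul_of_nonneg_left (hexp hδε ht) hM0)
  have hU {t : ℝ} (ht : 0 ≤ t) : ‖U t‖ ≤ M' * Real.exp (-(2 * δ) * t) :=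
    (hM' t ht).trans (mul_le_mul_of_nonneg_left (hexp hδε' ht) hM0')
  refine ⟨M + (M * M' * ‖K‖ / δ + ‖E‖ * M' + M * ‖E‖) + M', δ, hδ, fun t ht => ?_⟩
  have he := Real.exp_pos (-δ * t)
  refine ContinuousLinearMap.opNorm_le_bound _ (by positivity) fun p => ?_
  obtain ⟨x, y⟩ := p
  have hx : ‖x‖ ≤ ‖(x, y)‖ := norm_fst_le (x, y)
  have hy : ‖y‖ ≤ ‖(x, y)‖ := norm_snd_le (x, y)
  set n := ‖(x, y)‖
  have hTt : ‖T t‖ ≤ M * Real.exp (-δ * t) :=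
    (hT ht).trans (mul_le_mul_of_nonneg_left (hexp₂ ht) hM0)
  have hUt : ‖U t‖ ≤ M' * Real.exp (-δ * t) :=
    (hU ht).trans (mul_le_mul_of_nonneg_left (hexp₂ ht) hM0')
  have h₁ : ‖T t x‖ ≤ M * Real.exp (-δ * t) * n := (T t).le_of_opNorm_le_of_le hTt hx
  have h₂ : ‖U t y‖ ≤ M' * Real.exp (-δ * t) * n := (U t).le_of_opNorm_le_of_le hUt hy
  have h₃ : ‖E (U t y)‖ ≤ ‖E‖ * (M' * Real.exp (-δ * t) * n) := E.le_opNorm_of_le h₂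
  have h₄ : ‖T t (E y)‖ ≤ M * Real.exp (-δ * t) * (‖E‖ * n) :=
    (T t).le_of_opNorm_le_of_le hTt (E.le_opNorm_of_le hy)
  have h₅ : ‖convolutionOp T K U t y‖ ≤ M * M' * ‖K‖ / δ * Real.exp (-δ * t) * n := by
    have hte : Real.exp (-(2 * δ) * t) * t ≤ Real.exp (-δ * t) / δ := by
      have h := Real.add_one_le_exp (δ * t)
      rw [le_div_iff₀ hδ]
      calc Real.exp (-(2 * δ) * t) * t * δ ≤ Real.exp (-(2 * δ) * t) * Real.exp (δ * t) := by
            rw [mul_assoc]; gcongr; linarith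
        _ = Real.exp (-δ * t) := by rw [← Real.exp_add]; ring_nf
    calc ‖convolutionOp T K U t y‖
        ≤ M * M' * Real.exp (-(2 * δ) * t) * ‖K‖ * ‖y‖ * t := by
          refine norm_convolutionOp_le K ht fun s hs => ?_
          refine (mul_le_mul (hT (sub_nonneg.2 hs.2)) (hU hs.1) (norm_nonneg _)
            (by positivity)).trans_eq ?_
          rw [mul_mul_mul_comm, ← Real.exp_add]
          ring_nf
      _ = M * M' * ‖K‖ * ‖y‖ * (Real.exp (-(2 * δ) * t) * t) := by ring
      _ ≤ M * M' * ‖K‖ * n * (Real.exp (-δ * t) / δ) := by gcongr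
      _ = M * M' * ‖K‖ / δ * Real.exp (-δ * t) * n := by ring
  rw [hW t ht]
  have h₆ := norm_add_le_of_le h₁ (norm_sub_le_of_le (norm_add_le_of_le h₅ h₃) h₄)
  have hn : 0 ≤ n := norm_nonneg _
  rw [Prod.norm_mk]
  refine (max_le_add_of_nonneg (norm_nonneg _) (norm_nonneg _)).trans
    ((add_le_add h₆ h₂).trans_eq ?_)
  ring

end Coupled

/-! ### Graphs of the operators and decoupling of the domain -/

namespace CoupledMatrix

variable {X bX bY : Type*}
  [NormedAddCommGroup X] [NormedSpace ℂ X]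
  [NormedAddCommGroup bX] [NormedSpace ℂ bX]
  [NormedAddCommGroup bY] [NormedSpace ℂ bY]
  (m : CoupledMatrix X bX bY)

theorem mem_graph_A₀ {u v : X} : (u, v) ∈ m.A₀.graph ↔
    ∃ hu : u ∈ m.A.domain, m.L ⟨u, hu⟩ = 0 ∧ m.A ⟨u, hu⟩ = v := by
  rw [LinearPMap.mem_graph_iff]
  constructor
  · rintro ⟨⟨a, ⟨⟨b, hb⟩, hbL, rfl⟩, ha⟩, rfl, rfl⟩
    exact ⟨ha, hbL, (LinearPMap.domRestrict_apply rfl).symm⟩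
  · rintro ⟨hu, hL, rfl⟩
    exact ⟨⟨u, ⟨⟨u, hu⟩, hL, rfl⟩, hu⟩, rfl, LinearPMap.domRestrict_apply rfl⟩

theorem mem_graph_boundaryD {x w : bX} : (x, w) ∈ m.boundaryD.graph ↔
    ∃ hx : x ∈ m.D.domain, x ∈ range m.ι ∧ m.D ⟨x, hx⟩ = w := by
  rw [LinearPMap.mem_graph_iff]
  constructor
  · rintro ⟨⟨a, ha, ha'⟩, rfl, rfl⟩
    exact ⟨ha', ha, (LinearPMap.domRestrict_apply rfl).symm⟩
  · rintro ⟨hx, hx', rfl⟩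
    exact ⟨⟨x, hx', hx⟩, rfl, LinearPMap.domRestrict_apply rfl⟩

theorem mem_graph_toOperator {u v : X} {x w : bX} : ((u, x), (v, w)) ∈ m.toOperator.graph ↔
    ∃ (hu : u ∈ m.A.domain) (hx : x ∈ m.D.domain), m.ι (m.L ⟨u, hu⟩) = x ∧
      m.A ⟨u, hu⟩ + m.B ⟨x, m.domD_le hx⟩ = v ∧
      m.C ⟨u, m.domA_le hu⟩ + m.D ⟨x, hx⟩ = w := by
  rw [LinearPMap.mem_graph_iff]
  constructor
  · rintro ⟨⟨⟨a, b⟩, ha, hb, hab⟩, h, h'⟩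
    obtain ⟨rfl, rfl⟩ := Prod.ext_iff.1 h
    obtain ⟨h₁, h₂⟩ := Prod.ext_iff.1 h'
    exact ⟨ha, hb, hab, h₁, h₂⟩
  · rintro ⟨hu, hx, hux, rfl, rfl⟩
    exact ⟨⟨(u, x), hu, hx, hux⟩, rfl, rfl⟩

/-- The operator matrix is similar to the triangular matrix `(A₀, K; 0, D)` with diagonal
domain. -/
theorem mem_graph_toOperator_iff {E K : bX →L[ℂ] X}
    (hE : m.ExtendsDirichlet 0 E) (hK : m.ExtendsBSubED E K) (hC : ∀ u : m.C.domain, m.C u = 0)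
    (u v : X) (x w : bX) : ((u, x), (v, w)) ∈ m.toOperator.graph ↔
      (u - E x, v - E w - K x) ∈ m.A₀.graph ∧ (x, w) ∈ m.boundaryD.graph := by
  rw [mem_graph_toOperator, mem_graph_A₀, mem_graph_boundaryD]
  constructor
  · rintro ⟨hu, hx, hux, rfl, rfl⟩
    -- By the coupling, `E x` is the Dirichlet solution with the boundary value of `u`, so `u - E x
    -- ∈ ker L` and `A (u - E x) = A u`.
    obtain ⟨hEx, hA, hL⟩ := hE (m.L ⟨u, hu⟩)
    simp only [hux] at hEx hA hL
    have hr : x ∈ range m.ι := ⟨_, hux⟩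
    have hsub : (⟨u - E x, m.A.domain.sub_mem hu hEx⟩ : m.A.domain) = ⟨u, hu⟩ - ⟨E x, hEx⟩ := rfl
    refine ⟨⟨m.A.domain.sub_mem hu hEx, ?_, ?_⟩, hx, hr, ?_⟩
    · rw [hsub, map_sub, hL, sub_self]
    · rw [hsub, LinearPMap.map_sub, hA, hK x hx hr, hC, zero_smul]
      simp only [zero_add]
      abel
    · rw [hC, zero_add]
  · rintro ⟨⟨hu, hLu, hAu⟩, hx, hr, rfl⟩
    obtain ⟨b, rfl⟩ := hr
    obtain ⟨hEx, hA, hL⟩ := hE b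
    have hu' : u ∈ m.A.domain := by
      have := m.A.domain.add_mem hu hEx
      rwa [sub_add_cancel] at this
    have hsub : (⟨u - E (m.ι b), hu⟩ : m.A.domain) = ⟨u, hu'⟩ - ⟨E (m.ι b), hEx⟩ := rfl
    -- Membership of `u - E x` in `ker L` is exactly the coupling condition.
    rw [hsub, map_sub, hL, sub_eq_zero] at hLu
    rw [hsub, LinearPMap.map_sub, hA, hK _ hx ⟨b, rfl⟩, zero_smul, sub_zero] at hAu
    refine ⟨hu', hx, by rw [hLu], ?_, by rw [hC, zero_add]⟩
    rw [hAu]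
    abel

end CoupledMatrix

/-! ### Generation, asymptotics and stability for the operator matrix -/

theorem mainTheorem8 {X bX bY : Type*}
    [NormedAddCommGroup X] [NormedSpace ℂ X] [CompleteSpace X]
    [NormedAddCommGroup bX] [NormedSpace ℂ bX] [CompleteSpace bX]
    [NormedAddCommGroup bY] [NormedSpace ℂ bY] [CompleteSpace bY]
    (m : CoupledMatrix X bX bY) (hm : m.BasicAssumptions)
    -- `A₀` is invertible, the Dirichlet operator extends to `E`, and `B - E D` is bounded
    (A₀inv : X →L[ℂ] X) (hA₀inv : IsBoundedInverse m.A₀ A₀inv)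
    (E : bX →L[ℂ] X) (hE : m.ExtendsDirichlet 0 E)
    (K : bX →L[ℂ] X) (hK : m.ExtendsBSubED E K)
    (hC : ∀ u : m.C.domain, m.C u = 0)
    (T₀ : C0Semigroup X) (hT₀ : IsGenerator T₀ m.A₀)
    (hT₀stable : UniformlyExponentiallyStable T₀)
    (U : C0Semigroup bX) (hU : IsGenerator U m.boundaryD) :
    -- assertions (1), (2), (3) for the convolution operators `S(t)`
    (∀ y : bX, BoundedOnHalfLine (fun t => U t y) →
      BoundedOnHalfLine (fun t => convolutionOp T₀ K U t y)) ∧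
    (∀ y : bX, BoundedOnHalfLine (fun t => U t y) →
      AsymptoticallyAlmostPeriodic (fun t => U t y) →
      AsymptoticallyAlmostPeriodic (fun t => convolutionOp T₀ K U t y)) ∧
    (∀ y z : bX, Tendsto (fun t => U t y) atTop (𝓝 z) →
      ∃ hz : z ∈ m.B.domain,
        Tendsto (fun t => convolutionOp T₀ K U t y) atTop (𝓝 (-A₀inv (m.B ⟨z, hz⟩)))) ∧
    -- the coupled matrix generates a semigroup `T`, with its matrix form
    ∃ T : C0Semigroup (X × bX), IsGenerator T m.toOperator ∧
      (∀ t : ℝ, 0 ≤ t → ∀ (x : X) (y : bX),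
        T t (x, y) =
          (T₀ t x + (convolutionOp T₀ K U t y + E (U t y) - T₀ t (E y)), U t y)) ∧
      -- assertions (1), (2), (3) for the upper right entry of `T`
      (∀ y : bX, BoundedOnHalfLine (fun t => U t y) →
        BoundedOnHalfLine (fun t => (T t (0, y)).1)) ∧
      (∀ y : bX, BoundedOnHalfLine (fun t => U t y) →
        AsymptoticallyAlmostPeriodic (fun t => U t y) →
        AsymptoticallyAlmostPeriodic (fun t => (T t (0, y)).1)) ∧
      (∀ y z : bX, Tendsto (fun t => U t y) atTop (𝓝 z) →
        ∃ hz : z ∈ m.B.domain,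
          Tendsto (fun t => (T t (0, y)).1) atTop (𝓝 (E z - A₀inv (m.B ⟨z, hz⟩)))) ∧
      -- assertion (4)
      (UniformlyExponentiallyStable U → UniformlyExponentiallyStable T) := by 
  obtain ⟨M, ε, hε, hM⟩ := hT₀stable
  have hM' := C0Semigroup.norm_le_const hε hM
  obtain ⟨W, hW⟩ := exists_coupledSemigroup K E hM' U
  have hW₀ (y : bX) (t : ℝ) (ht : 0 ≤ t) : (W t (0, y)).1 =
      convolutionOp T₀ K U t y + E (U t y) - T₀ t (E y) := by
    rw [hW t ht, map_zero, zero_add]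
  have hlim (y z : bX) (hy : Tendsto (fun t => U t y) atTop (𝓝 z)) :
      ∃ hz : z ∈ m.B.domain, (A₀inv (m.B ⟨z, hz⟩), K z) ∈ m.A₀.graph := by
    obtain ⟨hz, hr, hD⟩ := m.mem_graph_boundaryD.1 (C0Semigroup.mem_graph_of_tendsto hU hy)
    refine ⟨m.domD_le hz, ?_⟩
    obtain ⟨hx, hAx⟩ := hA₀inv.1 (m.B ⟨z, m.domD_le hz⟩)
    -- Since `D z = 0`, the relation `K z = B z - E D z` reduces to `K z = B z`.
    rw [hK z hz hr, hD, map_zero, sub_zero]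
    exact m.A₀.mem_graph_iff.2 ⟨⟨_, hx⟩, rfl, hAx⟩
  refine ⟨fun y hy => ?_, fun y hy hy' => ?_, fun y z hy => ?_, W, ?_, hW, fun y hy => ?_,
    fun y hy hy' => ?_, fun y z hy => ?_,
    fun h => uniformlyExponentiallyStable_coupledSemigroup K E hε hM h hW⟩
  -- The coupling lemmas yield `S(t) y` with zero lift and zero vector; the lift `E` and the vector
  -- `E y` yield the corner entry.
  · simpa using bounded_coupling K 0 hε hM 0 hy
  · simpa using asymptoticallyAlmostPeriodic_coupling K 0 hε hM 0 hy hy'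
  · obtain ⟨hz, hg⟩ := hlim y z hy
    exact ⟨hz, by simpa using tendsto_coupling K 0 hε hM hT₀ 0 hy hg⟩
  · rintro ⟨u, x⟩ ⟨v, w⟩
    rw [m.mem_graph_toOperator_iff hE hK hC, hT₀, hU,
      tendsto_coupledSemigroup_iff K E hM' hW]
  · obtain ⟨N, hN⟩ := bounded_coupling K E hε hM (E y) hy
    exact ⟨N, fun t ht => by simpa only [hW₀ y t ht] using hN t ht⟩
  · obtain ⟨g, h, hg, hh, hh0, hgh⟩ :=
      asymptoticallyAlmostPeriodic_coupling K E hε hM (E y) hy hy'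
    exact ⟨g, h, hg, hh, hh0, fun t ht => by simpa only [hW₀ y t ht] using hgh t ht⟩
  · obtain ⟨hz, hg⟩ := hlim y z hy
    refine ⟨hz, (tendsto_coupling K E hε hM hT₀ (E y) hy hg).congr' ?_⟩
    filter_upwards [eventually_ge_atTop 0] with t ht
    exact (hW₀ y t ht).symm
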